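/- Let $S$ be a non-empty compact Hausdorff space and let $\Gamma$ be a compact group acting continuously and transitively on $S$. Let $\mathbb{E}_{\pi\in\Gamma}$ denote integration against the Haar probability measure of $\Gamma$, and fix any $s_0\in S$. Let $C(S)$ be the space of continuous functions $S\to\mathbb{C}$. For $f,g\in C(S)$ put $$\langle f,g\rangle=\mathbb{E}_{\pi\in\Gamma}\,\overline{f(\pi(s_0))}\,g(\pi(s_0)),\qquad \|f\|_{L_p}=\Big(\mathbb{E}_{\pi\in\Gamma}|f(\pi(s_0))|^p\Big)^{1/p}\ (1\le p<\infty),\qquad \|f\|_{L_\infty}=\sup_{s\in S}|f(s)|,$$ and for a linear map $A\colon C(S)\to C(S)$ and $p,q\in[1,\infty]$ put $$\|A\|_{L_p\to L_q}=\sup\{|\langle g,Af\rangle| : f,g\in C(S),\ \|f\|_{L_p}\le 1,\ \|g\|_{L_{q'}}\le 1\}\in[0,\infty],\qquad \tfrac1q+\tfrac1{q'}=1.$$ For $\pi\in\Gamma$ and $f\in C(S)$ let $f^\pi(s)=f(\pi(s))$. A linear map $A\colon C(S)\to C(S)$ (not assumed continuous) is called transitive covariant with respect to $\Gamma$ if $A^\pi=A$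 for all $\pi\in\Gamma$, where $A^\pi f=(Af^\pi)^{\pi^{-1}}$. On $\mathbb{C}^n$ use the normalized inner product $\langle y,x\rangle=\frac1n\sum_{i=1}^n\overline{y_i}x_i$, the norm $\|x\|_{\ell_2}=\langle x,x\rangle^{1/2}$ and $\|x\|_{\ell_\infty}=\max_i|x_i|$. For $A\in M_n(\mathbb{C})$ let $$\|A\|_{\ell_\infty\to\ell_1}=\sup\{|\langle y,Ax\rangle| : \|x\|_{\ell_\infty}\le1,\ \|y\|_{\ell_\infty}\le 1\},$$ $$\|A\|_G=\sup\Big\{\Big|\frac1n\sum_{i,j=1}^nA_{ij}\langle x_i,y_j\rangle\Big| : d\in\mathbb{N},\ x_i,y_j\in\mathbb{C}^d,\ \|x_i\|_{\ell_2}\le1,\ \|y_j\|_{\ell_2}\le1\Big\},$$ and let $$K_G^{\mathbb{C}}=\sup\Big\{\frac{\|A\|_G}{\|A\|_{\ell_\infty\to\ell_1}} : n\in\mathbb{N},\ 0\ne A\in M_n(\mathbb{C})\Big\}$$ be the complex Grothendieck constant. Theorem (Conlon–Zhao). The constant $K_G^{\mathbb{C}}$ is finite, and every linear map $A\colon C(S)\to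 C(S)$ that is transitive covariant with respect to $\Gamma$ satisfies $$\|A\|_{L_2\to L_2}\le K_G^{\mathbb{C}}\,\|A\|_{L_\infty\to L_1}.$$ -/

import Mathlib

open MeasureTheory
open scoped ENNReal ComplexConjugate

namespace TransitiveCovariant

noncomputable section

/-! ### Normalized structure on `ℂⁿ` and the complex Grothendieck constant -/

/-- The normalized inner product `⟨y, x⟩ = 𝔼_{i ∈ [n]} conj (y i) * x i` on `ℂⁿ`. -/
def finInner {n : ℕ} (y x : Fin n → ℂ) : ℂ :=
  (1 / (n : ℂ)) * ∑ i, conj (y i) * x i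

/-- The normalized `ℓ₂` norm `(𝔼_{i ∈ [n]} |x i|²)^(1/2)` on `ℂⁿ`. -/
def finL2Norm {n : ℕ} (x : Fin n → ℂ) : ℝ :=
  Real.sqrt ((1 / (n : ℝ)) * ∑ i, ‖x i‖ ^ 2)

/-- The norm `‖A‖_{ℓ_∞ → ℓ_1} = sup {|⟨y, A x⟩| : ‖x‖_{ℓ_∞} ≤ 1, ‖y‖_{ℓ_∞} ≤ 1}` of a complex
matrix.  The norm of `Fin n → ℂ` is the maximum norm. -/
def matrixInftyOneNorm {n : ℕ} (A : Matrix (Fin n) (Fin n) ℂ) : ℝ≥0∞ :=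
  ⨆ (x : Fin n → ℂ) (y : Fin n → ℂ) (_ : ‖x‖ ≤ 1) (_ : ‖y‖ ≤ 1),
    ‖finInner y (A.mulVec x)‖ₑ

/-- The Grothendieck norm `‖A‖_G`: the supremum of `|(1/n) ∑ i j, A i j * ⟨x i, y j⟩|` over all
dimensions `d` and all vectors `x i`, `y j` in the unit ball of `ℂᵈ`. -/
def grothendieckNorm {n : ℕ} (A : Matrix (Fin n) (Fin n) ℂ) : ℝ≥0∞ :=
  ⨆ (d : ℕ) (x : Fin n → Fin d → ℂ) (y : Fin n → Fin d → ℂ)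
    (_ : ∀ i, finL2Norm (x i) ≤ 1) (_ : ∀ j, finL2Norm (y j) ≤ 1),
    ‖(1 / (n : ℂ)) * ∑ i, ∑ j, A i j * finInner (x i) (y j)‖ₑ

/-- The complex Grothendieck constant: the supremum of `‖A‖_G / ‖A‖_{ℓ_∞ → ℓ_1}` over all complex
square matrices of all sizes.  In `ℝ≥0∞` one has `0 / 0 = 0`, so `A = 0` does not contribute. -/
def complexGrothendieckConstant : ℝ≥0∞ :=
  ⨆ (n : ℕ) (A : Matrix (Fin n) (Fin n) ℂ), grothendieckNorm A / matrixInftyOneNorm A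

/-! ### Norms on `C(S)` induced by the Haar probability measure of a group acting on `S` -/

variable {Γ S : Type*} [Group Γ] [MulAction Γ S]

section Norms

variable [MeasurableSpace Γ] [TopologicalSpace S]

/-- The inner product `⟨f, g⟩ = 𝔼_{π ∈ Γ} conj (f (π s₀)) * g (π s₀)` on `C(S)`. -/
def haarInner (μ : Measure Γ) (s₀ : S) (f g : C(S, ℂ)) : ℂ :=
  ∫ π : Γ, conj (f (π • s₀)) * g (π • s₀) ∂μ

/-- The `L_p` norm on `C(S)`: `(𝔼_{π ∈ Γ} |f (π s₀)|^p)^(1/p)` for finite `p`, and the supremum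
norm for `p = ∞`. -/
def haarLpNorm [CompactSpace S] (μ : Measure Γ) (s₀ : S) (p : ℝ≥0∞) (f : C(S, ℂ)) : ℝ :=
  if p = ∞ then ‖f‖
  else (∫ π : Γ, ‖f (π • s₀)‖ ^ p.toReal ∂μ) ^ (1 / p.toReal)

/-- The norm `‖A‖_{L_p → L_q} = sup {|⟨g, A f⟩| : ‖f‖_{L_p} ≤ 1, ‖g‖_{L_{q'}} ≤ 1}` of a linear map
`A` on `C(S)`, where `q'` is the exponent dual to `q`.  It takes the value `∞` if the set is
unbounded. -/
def haarOpNorm [CompactSpace S] (μ : Measure Γ) (s₀ : S) (p q : ℝ≥0∞)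
    (A : C(S, ℂ) →ₗ[ℂ] C(S, ℂ)) : ℝ≥0∞ :=
  ⨆ (f : C(S, ℂ)) (g : C(S, ℂ)) (_ : haarLpNorm μ s₀ p f ≤ 1)
    (_ : haarLpNorm μ s₀ q.conjExponent g ≤ 1),
    ‖haarInner μ s₀ g (A f)‖ₑ

end Norms

/-! ### Covariant linear maps -/

section Covariance

variable [TopologicalSpace Γ] [TopologicalSpace S] [ContinuousSMul Γ S]

/-- The function `f^π(s) = f(π(s))`, as a linear map in `f`. -/
def translate (π : Γ) : C(S, ℂ) →ₗ[ℂ] C(S, ℂ) where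
  toFun f := ⟨fun s => f (π • s), f.continuous.comp (continuous_const_smul π)⟩
  map_add' _ _ := rfl
  map_smul' _ _ := rfl

/-- The linear map `A^π f = (A f^π)^{π⁻¹}`. -/
def conjugate (π : Γ) (A : C(S, ℂ) →ₗ[ℂ] C(S, ℂ)) : C(S, ℂ) →ₗ[ℂ] C(S, ℂ) :=
  translate π⁻¹ ∘ₗ A ∘ₗ translate π

variable (Γ) in
/-- `A` is transitive covariant with respect to `Γ`: the action of `Γ` on `S` is transitive and
`A^π = A` for all `π ∈ Γ`. -/
def IsTransitiveCovariant (A : C(S, ℂ) →ₗ[ℂ] C(S, ℂ)) : Prop :=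
  MulAction.IsPretransitive Γ S ∧ ∀ π : Γ, conjugate π A = A

end Covariance

end

end TransitiveCovariant

open scoped InnerProductSpace

/-! Covariance makes `⟨g, A f⟩` equal to `⟨g^π, A f^π⟩` for every `π`, so it may be averaged over
`Γ`. By compactness one partition of unity `ψ i` with base points `p i` gives `f^π ≈ ∑ f(π p_i) ψ_i`
and `g^π ≈ ∑ g(π p_i) ψ_i` uniformly in `π`. Averaging turns the form into `∑ a i j ⟪x i, y j⟫`,
where `a i j = ⟨ψ_i, A ψ_j⟩` and `x i`, `y j` are the functions `π ↦ g(π p_i)`, `π ↦ f(π p_j)` in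
`L²(Γ)`. Transitivity and right invariance of Haar measure give these vectors the norms `‖g‖_{L_2}`
and `‖f‖_{L_2}` (`norm_orbitLp_eq`). The scalar form of `a` is bounded by `‖A‖_{L_∞ → L_1}`, so
Grothendieck's inequality (`norm_sum_inner_le_grothendieckConstant_mul`) concludes. When that norm
is finite, it also controls the approximation errors in place of continuity of `A`.

Finiteness of the constant is proved by realizing vectors as Rademacher sums and truncating: the
bounded parts are estimated pointwise by the scalar form, and the small remainders are absorbed into
the best constant. -/

namespace TransitiveCovariant

/-! ### Sesquilinear forms evaluated on Hilbert space vectors -/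

/-- A bound for `∑ a i j ⟪x i, y j⟫` over the unit balls of all finite-dimensional Hilbert spaces
holds in every Hilbert space. -/
theorem norm_sum_inner_le_of_euclidean {n : ℕ} {a : Matrix (Fin n) (Fin n) ℂ} {C : ℝ}
    (h : ∀ (d : ℕ) (x y : Fin n → EuclideanSpace ℂ (Fin d)), (∀ i, ‖x i‖ ≤ 1) →
      (∀ j, ‖y j‖ ≤ 1) → ‖∑ i, ∑ j, a i j * ⟪x i, y j⟫_ℂ‖ ≤ C)
    {H : Type*} [NormedAddCommGroup H] [InnerProductSpace ℂ H] (x y : Fin n → H)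
    (hx : ∀ i, ‖x i‖ ≤ 1) (hy : ∀ j, ‖y j‖ ≤ 1) :
    ‖∑ i, ∑ j, a i j * ⟪x i, y j⟫_ℂ‖ ≤ C := by
  -- Only the span of the finitely many vectors matters, and it is isometric to some `ℂᵈ`.
  let W : Submodule ℂ H := Submodule.span ℂ (Set.range x ∪ Set.range y)
  have hW : FiniteDimensional ℂ W :=
    FiniteDimensional.span_of_finite ℂ ((Set.finite_range x).union (Set.finite_range y))
  have hxW : ∀ i, x i ∈ W := fun i => Submodule.subset_span (Or.inl ⟨i, rfl⟩)
  have hyW : ∀ i, y i ∈ W := fun i => Submodule.subset_span (Or.inr ⟨i, rfl⟩)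
  let e := (stdOrthonormalBasis ℂ W).repr
  have key := h _ (fun i => e ⟨x i, hxW i⟩) (fun i => e ⟨y i, hyW i⟩)
    (fun i => by simpa using hx i) (fun i => by simpa using hy i)
  simpa only [LinearIsometryEquiv.inner_map_map, Submodule.coe_inner] using key

/-- Homogeneous form of a bound for `∑ a i j ⟪x i, y j⟫` over unit balls. -/
theorem norm_sum_inner_le_mul {n : ℕ} {a : Matrix (Fin n) (Fin n) ℂ} {C : ℝ}
    {H : Type*} [NormedAddCommGroup H] [InnerProductSpace ℂ H]
    (h : ∀ x y : Fin n → H, (∀ i, ‖x i‖ ≤ 1) →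
      (∀ j, ‖y j‖ ≤ 1) → ‖∑ i, ∑ j, a i j * ⟪x i, y j⟫_ℂ‖ ≤ C)
    (x y : Fin n → H) {r s : ℝ} (hr : 0 < r) (hs : 0 < s)
    (hx : ∀ i, ‖x i‖ ≤ r) (hy : ∀ j, ‖y j‖ ≤ s) :
    ‖∑ i, ∑ j, a i j * ⟪x i, y j⟫_ℂ‖ ≤ r * s * C := by
  have key := h (fun i => ((r⁻¹ : ℝ) : ℂ) • x i) (fun i => ((s⁻¹ : ℝ) : ℂ) • y i)
    (fun i => by
      rw [norm_smul, Complex.norm_real, Real.norm_of_nonneg (by positivity), inv_mul_le_iff₀ hr]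
      simpa using hx i)
    (fun i => by
      rw [norm_smul, Complex.norm_real, Real.norm_of_nonneg (by positivity), inv_mul_le_iff₀ hs]
      simpa using hy i)
  have e : ∑ i, ∑ j, a i j * ⟪((r⁻¹ : ℝ) : ℂ) • x i, ((s⁻¹ : ℝ) : ℂ) • y j⟫_ℂ
      = ((r⁻¹ * s⁻¹ : ℝ) : ℂ) * ∑ i, ∑ j, a i j * ⟪x i, y j⟫_ℂ := by
    simp only [inner_smul_left, inner_smul_right, Complex.conj_ofReal, Finset.mul_sum]
    refine Finset.sum_congr rfl fun i _ => Finset.sum_congr rfl fun j _ => ?_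
    push_cast
    ring
  rw [e, norm_mul, Complex.norm_real, Real.norm_of_nonneg (by positivity), ← mul_inv,
    inv_mul_le_iff₀ (by positivity)] at key
  exact key

/-! ### Second and fourth moments of Rademacher sums -/

/-- The Rademacher sum `∑ ± x k` attached to a choice of signs. -/
noncomputable def rademacherSum {d : ℕ} (x : Fin d → ℂ) (ω : Fin d → Bool) : ℂ :=
  ∑ k, (if ω k then x k else -x k)

theorem sum_signs_succ {E : Type*} [AddCommMonoid E] {d : ℕ} (F : (Fin (d + 1) → Bool) → E) :
    ∑ ω, F ω = ∑ ω : Fin d → Bool, (F (Fin.cons true ω) + F (Fin.cons false ω)) := by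
  rw [← (Fin.consEquiv fun _ => Bool).sum_comp, Fintype.sum_prod_type, Fintype.sum_bool,
    ← Finset.sum_add_distrib]
  rfl

theorem rademacherSum_cons {d : ℕ} (x : Fin (d + 1) → ℂ) (b : Bool) (ω : Fin d → Bool) :
    rademacherSum x (Fin.cons b ω)
      = (if b then x 0 else -x 0) + rademacherSum (fun k => x k.succ) ω := by
  simp [rademacherSum, Fin.sum_univ_succ]

/-- Cross terms cancel under independent signs, so `rademacherSum` is an isometry up to the factor
`√(2 ^ d)`. -/
theorem sum_conj_rademacherSum_mul {d : ℕ} (x y : Fin d → ℂ) :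
    ∑ ω, conj (rademacherSum x ω) * rademacherSum y ω = 2 ^ d * ∑ k, conj (x k) * y k := by
  induction d with
  | zero => simp [rademacherSum]
  | succ d ih =>
    have e : ∀ ω : Fin d → Bool,
        conj (rademacherSum x (Fin.cons true ω)) * rademacherSum y (Fin.cons true ω)
        + conj (rademacherSum x (Fin.cons false ω)) * rademacherSum y (Fin.cons false ω)
        = 2 * (conj (x 0) * y 0) + 2 * (conj (rademacherSum (fun k => x k.succ) ω)
          * rademacherSum (fun k => y k.succ) ω) := by
      intro ω
      simp only [rademacherSum_cons, map_add, if_true, Bool.false_eq_true, if_false, map_neg]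
      ring
    rw [sum_signs_succ, Finset.sum_congr rfl fun ω _ => e ω, Finset.sum_add_distrib,
      ← Finset.mul_sum Finset.univ (fun ω => conj (rademacherSum (fun k => x k.succ) ω)
        * rademacherSum (fun k => y k.succ) ω), ih, Fin.sum_univ_succ]
    simp
    ring

theorem sum_norm_rademacherSum_sq {d : ℕ} (x : Fin d → ℂ) :
    ∑ ω, ‖rademacherSum x ω‖ ^ 2 = 2 ^ d * ∑ k, ‖x k‖ ^ 2 := by
  have h := sum_conj_rademacherSum_mul x x
  simp only [Complex.conj_mul'] at h
  exact_mod_cast h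

/-- The defect is `8 (Im (u * conj v))²`, which is the square supplied to `nlinarith`. -/
theorem norm_add_pow_four_add_norm_neg_add_pow_four_le (u v : ℂ) :
    ‖u + v‖ ^ 4 + ‖-u + v‖ ^ 4 ≤ 2 * ‖v‖ ^ 4 + 12 * (‖u‖ ^ 2 * ‖v‖ ^ 2) + 2 * ‖u‖ ^ 4 := by
  have h (z : ℂ) : ‖z‖ ^ 4 = (‖z‖ ^ 2) ^ 2 := by ring
  simp only [h, Complex.sq_norm, Complex.normSq_apply, Complex.add_re, Complex.add_im,
    Complex.neg_re, Complex.neg_im]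
  nlinarith [sq_nonneg (u.re * v.im - u.im * v.re)]

theorem sum_norm_rademacherSum_pow_four_le {d : ℕ} (x : Fin d → ℂ) :
    ∑ ω, ‖rademacherSum x ω‖ ^ 4 ≤ 2 ^ d * (3 * (∑ k, ‖x k‖ ^ 2) ^ 2) := by
  induction d with
  | zero => simp [rademacherSum]
  | succ d ih =>
    set x' : Fin d → ℂ := fun k => x k.succ
    have e : ∀ ω : Fin d → Bool,
        ‖rademacherSum x (Fin.cons true ω)‖ ^ 4 + ‖rademacherSum x (Fin.cons false ω)‖ ^ 4
        ≤ 2 * ‖rademacherSum x' ω‖ ^ 4 + 12 * (‖x 0‖ ^ 2 * ‖rademacherSum x' ω‖ ^ 2)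
          + 2 * ‖x 0‖ ^ 4 := by
      intro ω
      simpa [rademacherSum_cons] using
        norm_add_pow_four_add_norm_neg_add_pow_four_le (x 0) (rademacherSum x' ω)
    rw [sum_signs_succ]
    refine (Finset.sum_le_sum fun ω _ => e ω).trans ?_
    rw [Finset.sum_add_distrib, Finset.sum_add_distrib, ← Finset.mul_sum, ← Finset.mul_sum,
      ← Finset.mul_sum, sum_norm_rademacherSum_sq, Fin.sum_univ_succ]
    have := ih x'
    set p := ∑ k, ‖x' k‖ ^ 2
    have hp : (0 : ℝ) ≤ 2 ^ d * ‖x 0‖ ^ 4 := by positivity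
    simp only [Finset.sum_const, Finset.card_univ, Fintype.card_pi, Fintype.card_bool,
      Finset.prod_const, Fintype.card_fin, nsmul_eq_mul, Nat.cast_pow, Nat.cast_ofNat]
    have := mul_le_mul_of_nonneg_left this zero_le_two
    calc _ ≤ _ := add_le_add_left (add_le_add_left this _) _
      _ ≤ _ := by
        -- The cross terms `12 * 2 ^ d * ‖x 0‖² * p` cancel exactly, leaving `4 * 2 ^ d * ‖x 0‖ ^
        -- 4`.
        rw [← sub_nonneg]
        ring_nf
        positivity

/-! ### Grothendieck's inequality by truncation -/

/-- Truncation of a complex number at absolute value `8`. -/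
noncomputable def trunc (z : ℂ) : ℂ := if ‖z‖ ≤ 8 then z else 0

theorem norm_trunc_le (z : ℂ) : ‖trunc z‖ ≤ 8 := by
  unfold trunc; split_ifs with h <;> simp [h]

theorem norm_trunc_le_norm (z : ℂ) : ‖trunc z‖ ≤ ‖z‖ := by
  unfold trunc; split_ifs with h <;> simp

/-- Chebyshev's argument: the difference is nonzero only where `‖z‖ > 8`, so the fourth moment
controls the tail. -/
theorem norm_sub_trunc_sq_le (z : ℂ) : ‖z - trunc z‖ ^ 2 ≤ ‖z‖ ^ 4 / 64 := by
  unfold trunc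
  split_ifs with h
  · simp; positivity
  · rw [sub_zero]
    nlinarith [sq_nonneg ‖z‖, mul_nonneg (sq_nonneg ‖z‖) (by nlinarith : 0 ≤ ‖z‖ ^ 2 - 64)]

/-- One step of the truncation argument for Grothendieck's inequality. -/
theorem norm_sum_inner_le_truncation {n : ℕ} {a : Matrix (Fin n) (Fin n) ℂ} {C T : ℝ}
    (hT : ∀ s t : Fin n → ℂ, (∀ i, ‖s i‖ ≤ 1) → (∀ j, ‖t j‖ ≤ 1) →
      ‖∑ i, ∑ j, a i j * (conj (s i) * t j)‖ ≤ T)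
    (hC : ∀ (d : ℕ) (x y : Fin n → EuclideanSpace ℂ (Fin d)), (∀ i, ‖x i‖ ≤ 1) →
      (∀ j, ‖y j‖ ≤ 1) → ‖∑ i, ∑ j, a i j * ⟪x i, y j⟫_ℂ‖ ≤ C)
    {d : ℕ} (x y : Fin n → EuclideanSpace ℂ (Fin d)) (hx : ∀ i, ‖x i‖ ≤ 1)
    (hy : ∀ j, ‖y j‖ ≤ 1) :
    ‖∑ i, ∑ j, a i j * ⟪x i, y j⟫_ℂ‖ ≤ 64 * T + C / 2 := by
  let Ω := Fin d → Bool
  let X : Fin n → EuclideanSpace ℂ Ω := fun i => WithLp.toLp 2 (rademacherSum (x i))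
  let Y : Fin n → EuclideanSpace ℂ Ω := fun i => WithLp.toLp 2 (rademacherSum (y i))
  let tr : EuclideanSpace ℂ Ω → EuclideanSpace ℂ Ω := fun u => WithLp.toLp 2 fun ω => trunc (u ω)
  set R : ℝ := Real.sqrt (2 ^ d) with hR
  have hR0 : 0 < R := by positivity
  have hR2 : R ^ 2 = 2 ^ d := Real.sq_sqrt (by positivity)
  have sum_le : ∀ u : EuclideanSpace ℂ (Fin d), ‖u‖ ≤ 1 → ∑ k, ‖u k‖ ^ 2 ≤ 1 := by
    intro u hu
    rw [← EuclideanSpace.norm_sq_eq]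
    exact pow_le_one₀ (norm_nonneg _) hu
  have norm_le : ∀ u : EuclideanSpace ℂ (Fin d), ‖u‖ ≤ 1 →
      ‖(WithLp.toLp 2 (rademacherSum u) : EuclideanSpace ℂ Ω)‖ ≤ R := by
    intro u hu
    refine abs_le_of_sq_le_sq' ?_ hR0.le |>.2
    rw [EuclideanSpace.norm_sq_eq, hR2]
    refine (sum_norm_rademacherSum_sq (fun k => u k)).le.trans ?_
    nlinarith [sum_le u hu, show (0:ℝ) < 2 ^ d by positivity]
  have tr_le : ∀ u : EuclideanSpace ℂ Ω, ‖tr u‖ ≤ ‖u‖ := by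
    intro u
    refine abs_le_of_sq_le_sq' ?_ (norm_nonneg _) |>.2
    rw [EuclideanSpace.norm_sq_eq, EuclideanSpace.norm_sq_eq]
    exact Finset.sum_le_sum fun ω _ => pow_le_pow_left₀ (norm_nonneg _) (norm_trunc_le_norm _) 2
  have sub_tr_le : ∀ u : EuclideanSpace ℂ (Fin d), ‖u‖ ≤ 1 →
      ‖(WithLp.toLp 2 (rademacherSum u) : EuclideanSpace ℂ Ω)
        - tr (WithLp.toLp 2 (rademacherSum u))‖ ≤ R / 4 := by
    intro u hu
    refine abs_le_of_sq_le_sq' ?_ (by positivity) |>.2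
    rw [EuclideanSpace.norm_sq_eq, div_pow, hR2]
    refine (Finset.sum_le_sum fun ω _ => norm_sub_trunc_sq_le (rademacherSum u ω)).trans ?_
    rw [← Finset.sum_div]
    have h4 := sum_norm_rademacherSum_pow_four_le (fun k => u k)
    have h1 := sum_le u hu
    have h0 : 0 ≤ ∑ k, ‖u k‖ ^ 2 := Finset.sum_nonneg fun _ _ => by positivity
    have h2 : (∑ k, ‖u k‖ ^ 2) ^ 2 ≤ 1 := pow_le_one₀ h0 h1
    have hd : (0:ℝ) < 2 ^ d := by positivity
    -- The squared tail is at most `3 * 2 ^ d / 64`, below `(R / 4)² = 2 ^ d / 16`; this is why the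
    -- cutoff is `8`.
    nlinarith
  have inner_XY : ∀ i j, ⟪X i, Y j⟫_ℂ = (2 : ℂ) ^ d * ⟪x i, y j⟫_ℂ := by
    intro i j
    have := sum_conj_rademacherSum_mul (x i) (y j)
    simp only [PiLp.inner_apply, RCLike.inner_apply']
    exact this
  have hΩ := norm_sum_inner_le_of_euclidean (H := EuclideanSpace ℂ Ω) hC
  have b1 := norm_sum_inner_le_mul hΩ (fun i => X i - tr (X i)) (fun j => tr (Y j))
    (r := R / 4) (by positivity) hR0
    (fun i => sub_tr_le _ (hx i)) (fun j => (tr_le _).trans (norm_le _ (hy j)))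
  have b2 := norm_sum_inner_le_mul hΩ X (fun j => Y j - tr (Y j)) (s := R / 4) hR0 (by positivity)
    (fun i => norm_le _ (hx i)) (fun j => sub_tr_le _ (hy j))
  -- For each fixed sign pattern the truncated values divided by `8` are admissible scalars for
  -- `hT`; hence `64 = 8²`.
  have b3 : ‖∑ i, ∑ j, a i j * ⟪tr (X i), tr (Y j)⟫_ℂ‖ ≤ 2 ^ d * (64 * T) := by
    have e : ∑ i, ∑ j, a i j * ⟪tr (X i), tr (Y j)⟫_ℂ = ∑ ω : Ω, 64 * ∑ i, ∑ j,
        a i j * (conj (trunc (X i ω) / 8) * (trunc (Y j ω) / 8)) := by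
      simp only [PiLp.inner_apply, RCLike.inner_apply', Finset.mul_sum]
      rw [Finset.sum_comm]
      simp only [Finset.sum_comm (s := (Finset.univ : Finset Ω))]
      rw [Finset.sum_comm]
      refine Finset.sum_congr rfl fun i _ => Finset.sum_congr rfl fun j _ =>
        Finset.sum_congr rfl fun ω _ => ?_
      simp only [tr, map_div₀, map_ofNat]
      ring
    have hb : ∀ ω : Ω, ‖(64 : ℂ) * ∑ i, ∑ j,
        a i j * (conj (trunc (X i ω) / 8) * (trunc (Y j ω) / 8))‖ ≤ 64 * T := by
      intro ω
      rw [norm_mul]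
      have := hT (fun i => trunc (X i ω) / 8) (fun j => trunc (Y j ω) / 8)
        (fun i => by simpa [div_le_one] using norm_trunc_le _)
        (fun i => by simpa [div_le_one] using norm_trunc_le _)
      simpa using this
    rw [e]
    refine (norm_sum_le_of_le _ fun ω _ => hb ω).trans ?_
    simp [Ω]
  have split : (2 : ℂ) ^ d * ∑ i, ∑ j, a i j * ⟪x i, y j⟫_ℂ
      = (∑ i, ∑ j, a i j * ⟪tr (X i), tr (Y j)⟫_ℂ
        + ∑ i, ∑ j, a i j * ⟪X i - tr (X i), tr (Y j)⟫_ℂ)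
        + ∑ i, ∑ j, a i j * ⟪X i, Y j - tr (Y j)⟫_ℂ := by
    simp only [Finset.mul_sum, ← Finset.sum_add_distrib]
    refine Finset.sum_congr rfl fun i _ => Finset.sum_congr rfl fun j _ => ?_
    rw [inner_sub_left, inner_sub_right, inner_XY]
    ring
  have hn := congrArg norm split
  rw [norm_mul, norm_pow, Complex.norm_ofNat] at hn
  have ht := (norm_add_le (∑ i, ∑ j, a i j * ⟪tr (X i), tr (Y j)⟫_ℂ
        + ∑ i, ∑ j, a i j * ⟪X i - tr (X i), tr (Y j)⟫_ℂ)
        (∑ i, ∑ j, a i j * ⟪X i, Y j - tr (Y j)⟫_ℂ)).trans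
        (add_le_add_left (norm_add_le _ _) _)
  rw [← hn] at ht
  have hd : (0:ℝ) < 2 ^ d := by positivity
  refine le_of_mul_le_mul_left ?_ hd
  have e : (2:ℝ) ^ d * (64 * T + C / 2)
      = 2 ^ d * (64 * T) + R / 4 * R * C + R * (R / 4) * C := by
    rw [← hR2]
    ring
  linarith

/-- Grothendieck's inequality for complex matrices, with constant `128`. -/
theorem norm_sum_inner_le_of_bound {n : ℕ} {a : Matrix (Fin n) (Fin n) ℂ} {T : ℝ}
    (hT : ∀ s t : Fin n → ℂ, (∀ i, ‖s i‖ ≤ 1) → (∀ j, ‖t j‖ ≤ 1) →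
      ‖∑ i, ∑ j, a i j * (conj (s i) * t j)‖ ≤ T)
    {d : ℕ} (x y : Fin n → EuclideanSpace ℂ (Fin d)) (hx : ∀ i, ‖x i‖ ≤ 1)
    (hy : ∀ j, ‖y j‖ ≤ 1) :
    ‖∑ i, ∑ j, a i j * ⟪x i, y j⟫_ℂ‖ ≤ 128 * T := by
  let V : Set ℝ := {v | ∃ (d : ℕ) (x y : Fin n → EuclideanSpace ℂ (Fin d)), (∀ i, ‖x i‖ ≤ 1) ∧
    (∀ j, ‖y j‖ ≤ 1) ∧ ‖∑ i, ∑ j, a i j * ⟪x i, y j⟫_ℂ‖ = v}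
  -- A finite supremum is needed to solve `sSup V ≤ 64 * T + sSup V / 2`.
  have hbdd : BddAbove V := by
    refine ⟨∑ i, ∑ j, ‖a i j‖, ?_⟩
    rintro v ⟨d, x, y, hx, hy, rfl⟩
    refine norm_sum_le_of_le _ fun i _ => norm_sum_le_of_le _ fun j _ => ?_
    rw [norm_mul]
    refine mul_le_of_le_one_right (norm_nonneg _) ((norm_inner_le_norm _ _).trans ?_)
    exact mul_le_one₀ (hx i) (norm_nonneg _) (hy j)
  have hV : ∀ (d : ℕ) (x y : Fin n → EuclideanSpace ℂ (Fin d)), (∀ i, ‖x i‖ ≤ 1) →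
      (∀ j, ‖y j‖ ≤ 1) → ‖∑ i, ∑ j, a i j * ⟪x i, y j⟫_ℂ‖ ≤ sSup V :=
    fun d x y hx hy => le_csSup hbdd ⟨d, x, y, hx, hy, rfl⟩
  have hs : sSup V ≤ 64 * T + sSup V / 2 := by
    refine csSup_le ⟨_, d, x, y, hx, hy, rfl⟩ ?_
    rintro v ⟨d, x, y, hx, hy, rfl⟩
    exact norm_sum_inner_le_truncation hT hV x y hx hy
  linarith [hV d x y hx hy]

/-! ### Normalized norms and the complex Grothendieck constant -/

theorem finInner_mulVec {n : ℕ} (A : Matrix (Fin n) (Fin n) ℂ) (x y : Fin n → ℂ) :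
    finInner y (A.mulVec x) = (1 / (n : ℂ)) * ∑ i, ∑ j, A i j * (conj (y i) * x j) := by
  simp only [finInner, Matrix.mulVec, dotProduct, Finset.mul_sum]
  refine Finset.sum_congr rfl fun i _ => Finset.sum_congr rfl fun j _ => ?_
  ring

theorem ofReal_sqrt_mul_self (d : ℕ) : ((Real.sqrt d : ℝ) : ℂ) * (Real.sqrt d : ℝ) = d := by
  rw [← Complex.ofReal_mul, Real.mul_self_sqrt (Nat.cast_nonneg d), Complex.ofReal_natCast]

/-- The complex Grothendieck inequality with constant `128`. -/
theorem grothendieckNorm_le {n : ℕ} (A : Matrix (Fin n) (Fin n) ℂ) :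
    grothendieckNorm A ≤ 128 * matrixInftyOneNorm A := by
  rcases eq_or_ne (matrixInftyOneNorm A) ⊤ with htop | htop
  · simp [htop]
  set T := (matrixInftyOneNorm A).toReal with hTdef
  have hT : ∀ s t : Fin n → ℂ, (∀ i, ‖s i‖ ≤ 1) → (∀ j, ‖t j‖ ≤ 1) →
      ‖(1 / (n : ℂ)) * ∑ i, ∑ j, A i j * (conj (s i) * t j)‖ ≤ T := by
    intro s t hs ht
    rw [← finInner_mulVec, ← toReal_enorm]
    refine ENNReal.toReal_mono htop ?_
    exact le_iSup₂_of_le t s (le_iSup₂_of_le ((pi_norm_le_iff_of_nonneg zero_le_one).2 ht)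
      ((pi_norm_le_iff_of_nonneg zero_le_one).2 hs) le_rfl)
  refine iSup_le fun d => iSup₂_le fun x y => iSup₂_le fun hx hy => ?_
  -- For `d = 0` the convention `0⁻¹ = 0` matches `1 / 0 = 0` in `finInner`.
  let r : ℂ := ((Real.sqrt d)⁻¹ : ℝ)
  let u : (Fin d → ℂ) → EuclideanSpace ℂ (Fin d) := fun z => WithLp.toLp 2 fun k => r * z k
  have hu : ∀ z w, ⟪u z, u w⟫_ℂ = finInner z w := by
    intro z w
    have hr : r * r = 1 / (d : ℂ) := by
      rw [one_div, ← ofReal_sqrt_mul_self d, mul_inv]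
      simp [r]
    simp only [PiLp.inner_apply, RCLike.inner_apply', finInner, u, Finset.mul_sum, ← hr]
    refine Finset.sum_congr rfl fun k _ => ?_
    simp only [map_mul, r, Complex.conj_ofReal]
    ring
  have hnu : ∀ z, finL2Norm z ≤ 1 → ‖u z‖ ≤ 1 := by
    intro z hz
    rw [EuclideanSpace.norm_eq]
    refine le_of_eq_of_le ?_ hz
    simp only [finL2Norm, u, norm_mul, mul_pow, ← Finset.mul_sum, r, Complex.norm_real,
      norm_inv, inv_pow, Real.norm_of_nonneg (Real.sqrt_nonneg _),
      Real.sq_sqrt (Nat.cast_nonneg d), one_div]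
  have key := norm_sum_inner_le_of_bound (a := fun i j => (1 / (n : ℂ)) * A i j) (T := T)
    (fun s t hs ht => by simpa only [mul_assoc, ← Finset.mul_sum] using hT s t hs ht)
    (fun i => u (x i)) (fun j => u (y j)) (fun i => hnu _ (hx i)) (fun j => hnu _ (hy j))
  simp only [mul_assoc, ← Finset.mul_sum, hu] at key
  rw [← ofReal_norm, ← ENNReal.ofReal_toReal htop, ← ENNReal.ofReal_ofNat,
    ← ENNReal.ofReal_mul (by norm_num)]
  exact ENNReal.ofReal_le_ofReal key

theorem complexGrothendieckConstant_lt_top : complexGrothendieckConstant < ∞ :=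
  (iSup₂_le fun _ A => ENNReal.div_le_of_le_mul (grothendieckNorm_le A) :
    complexGrothendieckConstant ≤ 128).trans_lt (by simp)

theorem enorm_sum_inner_le_grothendieckNorm {n : ℕ} (A : Matrix (Fin n) (Fin n) ℂ) {d : ℕ}
    (x y : Fin n → EuclideanSpace ℂ (Fin d)) (hx : ∀ i, ‖x i‖ ≤ 1) (hy : ∀ j, ‖y j‖ ≤ 1) :
    ‖(1 / (n : ℂ)) * ∑ i, ∑ j, A i j * ⟪x i, y j⟫_ℂ‖ₑ ≤ grothendieckNorm A := by
  rcases Nat.eq_zero_or_pos d with rfl | hd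
  · simp [PiLp.inner_apply]
  have hd' : (d : ℂ) ≠ 0 := by exact_mod_cast hd.ne'
  let u : EuclideanSpace ℂ (Fin d) → Fin d → ℂ := fun z k => ((Real.sqrt d : ℝ) : ℂ) * z k
  have hu : ∀ z w, finInner (u z) (u w) = ⟪z, w⟫_ℂ := by
    intro z w
    simp only [PiLp.inner_apply, RCLike.inner_apply', finInner, u, Finset.mul_sum]
    refine Finset.sum_congr rfl fun k _ => ?_
    rw [map_mul, Complex.conj_ofReal, mul_mul_mul_comm, ofReal_sqrt_mul_self, ← mul_assoc,
      one_div, inv_mul_cancel₀ hd', one_mul]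
  have hnu : ∀ z, ‖z‖ ≤ 1 → finL2Norm (u z) ≤ 1 := by
    intro z hz
    refine le_of_eq_of_le ?_ hz
    rw [EuclideanSpace.norm_eq]
    simp only [finL2Norm, u, norm_mul, mul_pow, ← Finset.mul_sum, Complex.norm_real,
      Real.norm_of_nonneg (Real.sqrt_nonneg _), Real.sq_sqrt (Nat.cast_nonneg d)]
    rw [one_div, inv_mul_cancel_left₀ (by exact_mod_cast hd.ne')]
  simp only [← hu]
  exact le_iSup_of_le d (le_iSup₂_of_le (fun i => u (x i)) (fun j => u (y j))
    (le_iSup₂_of_le (fun i => hnu _ (hx i)) (fun j => hnu _ (hy j)) le_rfl))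

/-- Grothendieck's inequality in an arbitrary Hilbert space, with the optimal constant. -/
theorem norm_sum_inner_le_grothendieckConstant_mul {n : ℕ} {a : Matrix (Fin n) (Fin n) ℂ} {T : ℝ}
    (hT : ∀ s t : Fin n → ℂ, (∀ i, ‖s i‖ ≤ 1) → (∀ j, ‖t j‖ ≤ 1) →
      ‖∑ i, ∑ j, a i j * (conj (s i) * t j)‖ ≤ T)
    {H : Type*} [NormedAddCommGroup H] [InnerProductSpace ℂ H] (x y : Fin n → H)
    (hx : ∀ i, ‖x i‖ ≤ 1) (hy : ∀ j, ‖y j‖ ≤ 1) :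
    ‖∑ i, ∑ j, a i j * ⟪x i, y j⟫_ℂ‖ ≤ complexGrothendieckConstant.toReal * T := by
  have hT0 : 0 ≤ T := (norm_nonneg _).trans (hT 0 0 (by simp) (by simp))
  rcases Nat.eq_zero_or_pos n with rfl | hn
  · simpa using mul_nonneg ENNReal.toReal_nonneg hT0
  have hn' : (0 : ℝ) < n := by exact_mod_cast hn
  have hnorm : ∀ z : ℂ, ‖(1 / (n : ℂ)) * z‖ = ‖z‖ / n := by
    intro z
    rw [norm_mul, norm_div, norm_one, Complex.norm_natCast]
    ring
  have h1 : matrixInftyOneNorm a ≤ ENNReal.ofReal (T / n) := by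
    refine iSup₂_le fun t s => iSup₂_le fun ht hs => ?_
    rw [finInner_mulVec, ← ofReal_norm, hnorm]
    refine ENNReal.ofReal_le_ofReal (div_le_div_of_nonneg_right (hT s t ?_ ?_) hn'.le)
    · exact fun i => (norm_le_pi_norm s i).trans hs
    · exact fun i => (norm_le_pi_norm t i).trans ht
  have hK := complexGrothendieckConstant_lt_top.ne
  -- If `matrixInftyOneNorm a = 0`, finiteness of the constant excludes the quotient `∞` and forces
  -- `grothendieckNorm a = 0`.
  have h2 : grothendieckNorm a ≤ complexGrothendieckConstant * ENNReal.ofReal (T / n) :=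
    ((ENNReal.div_le_iff_le_mul (Or.inr hK)
      (Or.inl (ne_top_of_le_ne_top ENNReal.ofReal_ne_top h1))).1
      (le_iSup₂_of_le n a le_rfl)).trans (mul_le_mul_right h1 _)
  refine norm_sum_inner_le_of_euclidean (fun d x y hx hy => ?_) x y hx hy
  have h3 := (enorm_sum_inner_le_grothendieckNorm a x y hx hy).trans h2
  have h4 := ENNReal.toReal_mono (ENNReal.mul_ne_top hK ENNReal.ofReal_ne_top) h3
  rw [toReal_enorm, hnorm, ENNReal.toReal_mul, ENNReal.toReal_ofReal (by positivity),
    ← mul_div_assoc, div_le_div_iff_of_pos_right hn'] at h4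
  exact h4

/-- Needed because `0 * ∞ = 0` in `ℝ≥0∞`, which would spoil the case of infinite `L_∞ → L_1` norm.
-/
theorem complexGrothendieckConstant_ne_zero : complexGrothendieckConstant ≠ 0 := by
  intro h
  have := norm_sum_inner_le_grothendieckConstant_mul (n := 1) (a := 1) (T := 1)
    (fun s t hs ht => by simpa using mul_le_one₀ (hs 0) (norm_nonneg _) (ht 0))
    (fun _ => (1 : ℂ)) (fun _ => (1 : ℂ)) (by simp) (by simp)
  norm_num [h] at this

/-! ### Unimodularity of compact groups -/

/-- A right translate of `μ` is left invariant, so uniqueness of Haar measure makes it a multiple of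
`μ` on continuous functions; the constant function `1` shows the factor is `1`. Restricting to
continuous integrands avoids assuming `μ` regular. -/
theorem integral_comp_mul_right_of_continuous {Γ : Type*} [Group Γ] [TopologicalSpace Γ]
    [IsTopologicalGroup Γ] [CompactSpace Γ] [MeasurableSpace Γ] [BorelSpace Γ]
    (μ : Measure Γ) [μ.IsHaarMeasure] [IsProbabilityMeasure μ] (σ : Γ) {h : Γ → ℝ}
    (hc : Continuous h) : ∫ π, h (π * σ) ∂μ = ∫ π, h π ∂μ := by
  have hm : Measurable (fun x : Γ => x * σ) := (continuous_mul_const σ).measurable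
  have key : ∀ h : Γ → ℝ, Continuous h → ∫ π, h (π * σ) ∂μ
      = (Measure.haarScalarFactor (μ.map (· * σ)) μ : ℝ) * ∫ π, h π ∂μ := by
    intro h hc
    have := Measure.integral_isMulLeftInvariant_eq_smul_of_hasCompactSupport (μ.map (· * σ)) μ hc
      (HasCompactSupport.of_compactSpace h)
    rwa [integral_map hm.aemeasurable hc.aestronglyMeasurable, integral_smul_nnreal_measure] at this
  have h1 := key (fun _ => 1) continuous_const
  simp only [integral_const, probReal_univ, smul_eq_mul, mul_one] at h1
  rw [key h hc, ← h1, one_mul]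

/-! ### Partitions of unity and translation invariance of the form -/

section Partition

variable {S : Type*} [TopologicalSpace S] [CompactSpace S]

/-- Approximation of a continuous function by a combination of a partition of unity. -/
theorem norm_sub_sum_smul_le {n : ℕ} {φ : Fin n → C(S, ℝ)} (h0 : ∀ i s, 0 ≤ φ i s)
    (h1 : ∀ s, ∑ i, φ i s = 1) {ψ : Fin n → C(S, ℂ)} (hψ : ∀ i s, ψ i s = (φ i s : ℂ))
    (h : C(S, ℂ)) (c : Fin n → ℂ) {ε : ℝ} (hε : 0 ≤ ε)
    (hc : ∀ i s, φ i s ≠ 0 → ‖h s - c i‖ ≤ ε) : ‖h - ∑ i, c i • ψ i‖ ≤ ε := by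
  rw [ContinuousMap.norm_le _ hε]
  intro s
  have e : (h - ∑ i, c i • ψ i) s = ∑ i, (φ i s : ℂ) * (h s - c i) := by
    simp only [mul_sub, Finset.sum_sub_distrib, ← Finset.sum_mul, ← Complex.ofReal_sum, h1,
      ContinuousMap.sub_apply, ContinuousMap.sum_apply, ContinuousMap.smul_apply, hψ, smul_eq_mul,
      Complex.ofReal_one, one_mul, mul_comm (c _)]
  rw [e]
  calc _ ≤ ∑ i, φ i s * ε := by
        refine norm_sum_le_of_le _ fun i _ => ?_
        rw [norm_mul, Complex.norm_real, Real.norm_of_nonneg (h0 i s)]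
        rcases eq_or_ne (φ i s) 0 with hz | hz
        · simp [hz]
        · exact mul_le_mul_of_nonneg_left (hc i s hz) (h0 i s)
    _ = ε := by rw [← Finset.sum_mul, h1, one_mul]

/-- A finite partition of unity, with base points, on whose members a continuous map to a metric
space is almost constant. -/
theorem exists_partition [T2Space S] {X : Type*} [PseudoMetricSpace X] (F : C(S, X)) {ε : ℝ}
    (hε : 0 < ε) : ∃ (n : ℕ) (φ : Fin n → C(S, ℝ)) (p : Fin n → S), (∀ i s, 0 ≤ φ i s) ∧
      (∀ s, ∑ i, φ i s = 1) ∧ ∀ i s, φ i s ≠ 0 → dist (F s) (F (p i)) < ε := by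
  let U : S → Set S := fun t => {s | dist (F s) (F t) < ε}
  have hU : ∀ t, IsOpen (U t) := fun t =>
    isOpen_lt (F.continuous.dist continuous_const) continuous_const
  obtain ⟨t, ht⟩ := isCompact_univ.elim_finite_subcover U hU
    (fun s _ => Set.mem_iUnion.2 ⟨s, by simpa [U] using hε⟩)
  obtain ⟨q, hq⟩ := PartitionOfUnity.exists_isSubordinate isClosed_univ
    (fun i : Fin t.card => U (t.equivFin.symm i)) (fun i => hU _) (fun s hs => by
      obtain ⟨i, hi, his⟩ := Set.mem_iUnion₂.1 (ht hs)
      exact Set.mem_iUnion.2 ⟨t.equivFin ⟨i, hi⟩, by simpa using his⟩)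
  refine ⟨t.card, fun i => q i, fun i => t.equivFin.symm i, fun i s => q.nonneg i s, fun s => ?_,
    fun i s hs => hq i (subset_tsupport _ hs)⟩
  rw [← finsum_eq_sum_of_fintype]
  exact q.sum_eq_one (Set.mem_univ s)

end Partition

/-- The sesquilinear form of a transitive covariant map is invariant under translations. -/
theorem haarInner_translate {Γ S : Type*} [Group Γ] [TopologicalSpace Γ] [IsTopologicalGroup Γ]
    [MeasurableSpace Γ] [BorelSpace Γ] (μ : Measure Γ) [μ.IsMulLeftInvariant]
    [TopologicalSpace S] [MulAction Γ S] [ContinuousSMul Γ S] (s₀ : S)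
    {A : C(S, ℂ) →ₗ[ℂ] C(S, ℂ)} (hA : IsTransitiveCovariant Γ A) (f g : C(S, ℂ)) (π : Γ) :
    haarInner μ s₀ (translate π g) (A (translate π f)) = haarInner μ s₀ g (A f) := by
  have hAf : A (translate π f) = translate π (A f) := by
    have h := congrArg (translate π) (LinearMap.congr_fun (hA.2 π) f)
    rw [← h]
    ext s
    simp [conjugate, translate]
  rw [hAf]
  simp only [haarInner, translate, LinearMap.coe_mk, AddHom.coe_mk, ContinuousMap.coe_mk,
    smul_smul]
  exact integral_mul_left_eq_self (fun τ : Γ => conj (g (τ • s₀)) * A f (τ • s₀)) π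

/-! ### Orbit functions in `L²(Γ)` and the averaging argument -/

section Haar

variable {Γ S : Type*} [Group Γ] [TopologicalSpace Γ] [CompactSpace Γ]
  [MeasurableSpace Γ] [BorelSpace Γ] (μ : Measure Γ) [IsProbabilityMeasure μ]
  [TopologicalSpace S] [MulAction Γ S] [ContinuousSMul Γ S]

/-- The pullback of a continuous function along the orbit map `π ↦ π • s`, in `L²`. -/
noncomputable def orbitLp (s : S) : C(S, ℂ) →ₗ[ℂ] Lp ℂ 2 μ :=
  (ContinuousMap.toLp 2 μ ℂ).toLinearMap ∘ₗ (ContinuousMap.compRightAlgHom ℂ ℂ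
    (⟨fun π : Γ => π • s, by fun_prop⟩ : C(Γ, S))).toLinearMap

theorem inner_orbitLp (s t : S) (f g : C(S, ℂ)) :
    ⟪orbitLp μ s f, orbitLp μ t g⟫_ℂ = ∫ π : Γ, conj (f (π • s)) * g (π • t) ∂μ := by
  refine (ContinuousMap.inner_toLp μ _ _).trans (integral_congr_ae (ae_of_all _ fun π => ?_))
  exact mul_comm _ _

theorem haarInner_eq_inner (s : S) (f g : C(S, ℂ)) :
    haarInner μ s f g = ⟪orbitLp μ s f, orbitLp μ s g⟫_ℂ := (inner_orbitLp μ s s f g).symm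

theorem norm_orbitLp_sq (s : S) (f : C(S, ℂ)) :
    ‖orbitLp μ s f‖ ^ 2 = ∫ π : Γ, ‖f (π • s)‖ ^ 2 ∂μ := by
  have h := inner_self_eq_norm_sq_to_K (𝕜 := ℂ) (orbitLp μ s f)
  rw [inner_orbitLp] at h
  simp only [Complex.conj_mul'] at h
  have e : ∫ π : Γ, ((‖f (π • s)‖ : ℂ)) ^ 2 ∂μ = ((∫ π : Γ, ‖f (π • s)‖ ^ 2 ∂μ : ℝ) : ℂ) := by
    have := integral_ofReal (𝕜 := ℂ) (μ := μ) (f := fun π : Γ => ‖f (π • s)‖ ^ 2)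
    simpa using this
  rw [e] at h
  exact Complex.ofReal_injective ((Complex.ofReal_pow _ _).trans h.symm)

/-- By transitivity, moving the base point is a right translation on `Γ`, which Haar measure
ignores. -/
theorem norm_orbitLp_eq [IsTopologicalGroup Γ] [μ.IsHaarMeasure] [MulAction.IsPretransitive Γ S]
    (s t : S) (f : C(S, ℂ)) : ‖orbitLp μ s f‖ = ‖orbitLp μ t f‖ := by
  obtain ⟨σ, rfl⟩ := MulAction.exists_smul_eq Γ t s
  rw [← sq_eq_sq₀ (norm_nonneg _) (norm_nonneg _), norm_orbitLp_sq, norm_orbitLp_sq]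
  simp only [smul_smul]
  exact integral_comp_mul_right_of_continuous μ σ (h := fun π => ‖f (π • t)‖ ^ 2) (by fun_prop)

theorem haarLpNorm_two [CompactSpace S] (s : S) (f : C(S, ℂ)) :
    haarLpNorm μ s 2 f = ‖orbitLp μ s f‖ := by
  rw [← Real.sqrt_sq (norm_nonneg (orbitLp μ s f)), norm_orbitLp_sq, Real.sqrt_eq_rpow]
  simp [haarLpNorm]

/-- The sesquilinear form of an operator with finite `L_∞ → L_1` norm is bounded. -/
theorem norm_haarInner_le [CompactSpace S] (s₀ : S) (A : C(S, ℂ) →ₗ[ℂ] C(S, ℂ))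
    (htop : haarOpNorm μ s₀ ∞ 1 A ≠ ∞) (f g : C(S, ℂ)) :
    ‖haarInner μ s₀ g (A f)‖ ≤ (haarOpNorm μ s₀ ∞ 1 A).toReal * ‖g‖ * ‖f‖ := by
  have unit : ∀ f g : C(S, ℂ), ‖f‖ ≤ 1 → ‖g‖ ≤ 1 →
      ‖haarInner μ s₀ g (A f)‖ ≤ (haarOpNorm μ s₀ ∞ 1 A).toReal := by
    intro f g hf hg
    rw [← toReal_enorm]
    refine ENNReal.toReal_mono htop (le_iSup₂_of_le f g (le_iSup₂_of_le ?_ ?_ le_rfl))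
    · simpa [haarLpNorm] using hf
    -- The exponent dual to `1` is `1 + 0⁻¹ = ∞`.
    · simpa [haarLpNorm, ENNReal.conjExponent] using hg
  rcases eq_or_ne f 0 with rfl | hf
  · simp [haarInner_eq_inner]
  rcases eq_or_ne g 0 with rfl | hg
  · simp [haarInner_eq_inner]
  have hf' := norm_pos_iff.2 hf
  have hg' := norm_pos_iff.2 hg
  have h := unit (((‖f‖⁻¹ : ℝ) : ℂ) • f) (((‖g‖⁻¹ : ℝ) : ℂ) • g)
    (by rw [norm_smul, Complex.norm_real, norm_inv, norm_norm, inv_mul_cancel₀ hf'.ne'])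
    (by rw [norm_smul, Complex.norm_real, norm_inv, norm_norm, inv_mul_cancel₀ hg'.ne'])
  rw [haarInner_eq_inner, map_smul, map_smul, map_smul, inner_smul_left, inner_smul_right,
    ← haarInner_eq_inner, Complex.conj_ofReal, norm_mul, norm_mul, Complex.norm_real,
    Complex.norm_real, norm_inv, norm_inv, norm_norm, norm_norm, inv_mul_le_iff₀ hg',
    inv_mul_le_iff₀ hf'] at h
  linarith

theorem haarInner_sum_sum (s₀ : S) (A : C(S, ℂ) →ₗ[ℂ] C(S, ℂ)) {n : ℕ} (ψ : Fin n → C(S, ℂ))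
    (c e : Fin n → ℂ) :
    haarInner μ s₀ (∑ i, c i • ψ i) (A (∑ j, e j • ψ j))
      = ∑ i, ∑ j, haarInner μ s₀ (ψ i) (A (ψ j)) * (conj (c i) * e j) := by
  simp only [haarInner_eq_inner, map_sum, map_smul, sum_inner, inner_sum, inner_smul_left,
    inner_smul_right, Finset.mul_sum]
  rw [Finset.sum_comm]
  refine Finset.sum_congr rfl fun i _ => Finset.sum_congr rfl fun j _ => ?_
  ring

/-- The Grothendieck bound for the sesquilinear form of a transitive covariant map. -/
theorem norm_haarInner_le_of_isTransitiveCovariant [IsTopologicalGroup Γ] [μ.IsHaarMeasure]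
    [CompactSpace S] [T2Space S] (s₀ : S) {A : C(S, ℂ) →ₗ[ℂ] C(S, ℂ)}
    (hA : IsTransitiveCovariant Γ A) (htop : haarOpNorm μ s₀ ∞ 1 A ≠ ∞) (f g : C(S, ℂ)) (hf : ‖orbitLp μ s₀ f‖ ≤ 1)
    (hg : ‖orbitLp μ s₀ g‖ ≤ 1) :
    ‖haarInner μ s₀ g (A f)‖
      ≤ complexGrothendieckConstant.toReal * (haarOpNorm μ s₀ ∞ 1 A).toReal := by
  have := hA.1
  set M := (haarOpNorm μ s₀ ∞ 1 A).toReal with hM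
  have hM0 : 0 ≤ M := ENNReal.toReal_nonneg
  have hB := norm_haarInner_le μ s₀ A htop
  rw [← hM] at hB
  have approx : ∀ ε : ℝ, 0 < ε → ‖haarInner μ s₀ g (A f)‖
      ≤ complexGrothendieckConstant.toReal * M + M * (‖f‖ + ‖g‖) * ε := by
    intro ε hε
    -- Viewing `h` as a map from `S` to `C(Γ, ℂ)` with the sup metric makes one partition serve all
    -- `π`; the product map treats `f` and `g` together.
    let F (h : C(S, ℂ)) : C(S, C(Γ, ℂ)) := ContinuousMap.curry ⟨fun q => h (q.2 • q.1), by fun_prop⟩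
    obtain ⟨n, φ, p, h0, h1, hφ⟩ := exists_partition ((F f).prodMk (F g)) hε
    let ψ : Fin n → C(S, ℂ) := fun i => ⟨fun s => (φ i s : ℂ), by fun_prop⟩
    have hψ : ∀ i s, ψ i s = (φ i s : ℂ) := fun _ _ => rfl
    have happ : ∀ (h : C(S, ℂ)), (∀ i s, φ i s ≠ 0 → dist (F h s) (F h (p i)) < ε) →
        ∀ π : Γ, ‖translate π h - ∑ i, h (π • p i) • ψ i‖ ≤ ε := by
      intro h hh π
      refine norm_sub_sum_smul_le h0 h1 hψ _ _ hε.le fun i s hs => ?_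
      have := (ContinuousMap.dist_apply_le_dist π).trans (hh i s hs).le
      rwa [dist_eq_norm] at this
    have hf' := happ f fun i s hs => (le_max_left _ _).trans_lt (hφ i s hs)
    have hg' := happ g fun i s hs => (le_max_right _ _).trans_lt (hφ i s hs)
    have hsum : ∀ (c : Fin n → ℂ) (r : ℝ), 0 ≤ r → (∀ i, ‖c i‖ ≤ r) → ‖∑ i, c i • ψ i‖ ≤ r := by
      intro c r hr hc
      simpa using norm_sub_sum_smul_le h0 h1 hψ 0 c hr fun i s _ => by simpa using hc i
    have htr : ∀ (h : C(S, ℂ)) (π : Γ), ‖translate π h‖ ≤ ‖h‖ := fun h π =>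
      (ContinuousMap.norm_le _ (norm_nonneg _)).2 fun s => h.norm_coe_le_norm _
    let a : Matrix (Fin n) (Fin n) ℂ := fun i j => haarInner μ s₀ (ψ i) (A (ψ j))
    have hG := norm_sum_inner_le_grothendieckConstant_mul (a := a) (T := M)
      -- Coefficients in the unit disc give combinations of the `ψ i` of sup norm at most `1`, so
      -- the scalar form of `a` is bounded by `M`.
      (fun s t hs ht => by
        rw [← haarInner_sum_sum]
        refine (hB _ _).trans ?_
        rw [mul_assoc]
        exact mul_le_of_le_one_right hM0 (mul_le_one₀ (hsum s 1 zero_le_one hs) (norm_nonneg _)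
          (hsum t 1 zero_le_one ht)))
      (fun i => orbitLp μ (p i) g) (fun j => orbitLp μ (p j) f)
      (fun i => (norm_orbitLp_eq μ (p i) s₀ g).trans_le hg)
      (fun j => (norm_orbitLp_eq μ (p j) s₀ f).trans_le hf)
    -- `D π` is the form at the approximants of `g^π` and `f^π`; its integral is the Grothendieck
    -- sum in `hG`.
    let D : Γ → ℂ := fun π => ∑ i, ∑ j, a i j * (conj (g (π • p i)) * f (π • p j))
    have hint : ∀ h : Γ → ℂ, Continuous h → Integrable h μ := fun h hc =>
      hc.integrable_of_hasCompactSupport (HasCompactSupport.of_compactSpace h)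
    have hD : ∑ i, ∑ j, a i j * ⟪orbitLp μ (p i) g, orbitLp μ (p j) f⟫_ℂ = ∫ π, D π ∂μ := by
      simp only [inner_orbitLp, D]
      rw [integral_finsetSum _ fun i _ => hint _ (by fun_prop)]
      refine Finset.sum_congr rfl fun i _ => ?_
      rw [integral_finsetSum _ fun j _ => hint _ (by fun_prop)]
      exact Finset.sum_congr rfl fun j _ => (integral_const_mul _ _).symm
    have hclose : ∀ π, ‖haarInner μ s₀ g (A f) - D π‖ ≤ M * (‖f‖ + ‖g‖) * ε := by
      intro π
      rw [← haarInner_translate μ s₀ hA f g π]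
      set f₁ := translate π f
      set g₁ := translate π g
      set f₂ := ∑ j, f (π • p j) • ψ j
      set g₂ := ∑ i, g (π • p i) • ψ i
      have e : D π = haarInner μ s₀ g₂ (A f₂) := (haarInner_sum_sum μ s₀ A ψ _ _).symm
      have split : haarInner μ s₀ g₁ (A f₁) - haarInner μ s₀ g₂ (A f₂)
          = haarInner μ s₀ (g₁ - g₂) (A f₁) + haarInner μ s₀ g₂ (A (f₁ - f₂)) := by
        simp only [haarInner_eq_inner, map_sub, inner_sub_left, inner_sub_right]
        ring
      rw [e, split]
      refine (norm_add_le _ _).trans ((add_le_add (hB _ _) (hB _ _)).trans ?_)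
      have i1 : M * ‖g₁ - g₂‖ * ‖f₁‖ ≤ M * ε * ‖f‖ := by
        gcongr
        exacts [hg' π, htr f π]
      have i2 : M * ‖g₂‖ * ‖f₁ - f₂‖ ≤ M * ‖g‖ * ε := by
        gcongr
        exacts [hsum _ _ (norm_nonneg _) fun i => g.norm_coe_le_norm _, hf' π]
      linarith
    have hdiff : ‖haarInner μ s₀ g (A f) - ∫ π, D π ∂μ‖ ≤ M * (‖f‖ + ‖g‖) * ε := by
      have e : haarInner μ s₀ g (A f) - ∫ π, D π ∂μ
          = ∫ π, (haarInner μ s₀ g (A f) - D π) ∂μ := by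
        rw [integral_sub (integrable_const _) (hint _ (by fun_prop))]
        simp
      rw [e]
      simpa using norm_integral_le_of_norm_le_const (μ := μ) (ae_of_all _ hclose)
    rw [hD] at hG
    calc _ = ‖(∫ π, D π ∂μ) + (haarInner μ s₀ g (A f) - ∫ π, D π ∂μ)‖ := by congr 1; ring
      _ ≤ _ := (norm_add_le _ _).trans (add_le_add hG hdiff)
  have hN : 0 ≤ M * (‖f‖ + ‖g‖) := by positivity
  -- The `+ 1` keeps the denominator positive when the error coefficient vanishes.
  refine le_of_forall_pos_le_add fun δ hδ => (approx (δ / (M * (‖f‖ + ‖g‖) + 1))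
    (by positivity)).trans ?_
  gcongr
  rw [← mul_div_assoc, div_le_iff₀ (by positivity)]
  linarith

end Haar

end TransitiveCovariant

theorem theorem3p1
    {Γ : Type*} [Group Γ] [TopologicalSpace Γ] [IsTopologicalGroup Γ] [CompactSpace Γ]
    [MeasurableSpace Γ] [BorelSpace Γ]
    (μ : Measure Γ) [μ.IsHaarMeasure] [IsProbabilityMeasure μ]
    {S : Type*} [TopologicalSpace S] [CompactSpace S] [T2Space S]
    [MulAction Γ S] [ContinuousSMul Γ S] (s₀ : S)
    (A : C(S, ℂ) →ₗ[ℂ] C(S, ℂ))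
    (hA : TransitiveCovariant.IsTransitiveCovariant Γ A) :
    TransitiveCovariant.complexGrothendieckConstant < ∞ ∧
      TransitiveCovariant.haarOpNorm μ s₀ 2 2 A ≤
        TransitiveCovariant.complexGrothendieckConstant *
          TransitiveCovariant.haarOpNorm μ s₀ ∞ 1 A := by
  refine ⟨TransitiveCovariant.complexGrothendieckConstant_lt_top, ?_⟩
  rcases eq_or_ne (TransitiveCovariant.haarOpNorm μ s₀ ∞ 1 A) ∞ with htop | htop
  · rw [htop, ENNReal.mul_top TransitiveCovariant.complexGrothendieckConstant_ne_zero]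
    exact le_top
  refine iSup₂_le fun f g => iSup₂_le fun hf hg => ?_
  have h2 : (2 : ℝ≥0∞).conjExponent = 2 := by
    rw [ENNReal.conjExponent, show (2 : ℝ≥0∞) - 1 = 1 from
      ENNReal.sub_eq_of_eq_add ENNReal.one_ne_top one_add_one_eq_two.symm, inv_one,
    one_add_one_eq_two]
  rw [TransitiveCovariant.haarLpNorm_two] at hf
  rw [h2, TransitiveCovariant.haarLpNorm_two] at hg
  have h := TransitiveCovariant.norm_haarInner_le_of_isTransitiveCovariant μ s₀ hA htop f g hf hg
  rw [← ENNReal.toReal_mul] at h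
  rwa [← ofReal_norm, ENNReal.ofReal_le_iff_le_toReal
    (ENNReal.mul_ne_top TransitiveCovariant.complexGrothendieckConstant_lt_top.ne htop)]
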